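/- Let $X$ be a complex manifold with complex structure $J$, and let $\pi\in\Gamma(\wedge^2T^{1,0}X)$ be a holomorphic Poisson bivector field on $X$, i.e. $\bar\partial\pi=0$ and $[\pi,\pi]=0$. Write $\pi=\pi_R+i\pi_I$ with real bivector fields $\pi_R,\pi_I\in\Gamma(\wedge^2TX)$ on the underlying real manifold. Then $\pi_R$ and $\pi_I$ are Poisson bivector fields, and their symplectic foliations coincide. Moreover, their symplectic leaves are exactly the holomorphic symplectic leaves of $\pi$. Here the symplectic leaves of a real Poisson bivector field $P$ are the maximal connected immersed submanifolds of $X$ whose tangent space at each point $x$ is $P^\sharp(T^*_xX)$. The holomorphic symplectic leaves of $\pi$ are the maximal connected immersed complex submanifolds whose holomorphic tangent space at each point $x$ is $\pi^\sharp((T^{1,0}_xX)^*)\subseteq T^{1,0}_xX$. In both cases "maximal" means that every connected immersed submanifold of the same kind that meets the leaf is an open submanifold of it. The symplectic foliation is the set of all symplectic leaves, and leaves are compared as immersed submanifolds, that is, as subsets of $X$ with their leaf topology and hence their manifold structure. -/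

import Mathlib

open scoped Manifold ContDiff Topology

noncomputable section

/-! Everything up to the real and imaginary parts is written once for a manifold over a field `𝕜`.
For `𝕜 = ℝ` and order of smoothness `∞` this is the theory of smooth manifolds, for `𝕜 = ℂ` it is
the theory of complex manifolds (a function that is infinitely often complex differentiable is
the same as a holomorphic function), and
`TangentSpace 𝓘(ℂ, E) x` is the holomorphic tangent space `T^{1,0}_x X`. -/

section General

variable (𝕜 : Type*) [NontriviallyNormedField 𝕜]
  (E : Type*) [NormedAddCommGroup E] [NormedSpace 𝕜 E]
  (X : Type*) [TopologicalSpace X] [ChartedSpace E X]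

/-- The cotangent space at `x`. For `𝕜 = ℂ` this is `(T^{1,0}_x X)^*`. -/
abbrev CotangentAt (x : X) : Type _ := TangentSpace 𝓘(𝕜, E) x →L[𝕜] 𝕜

/-- A (not yet smooth) section of `∧² T X`: at each point an alternating bilinear form on the
cotangent space. -/
structure BivectorField where
  /-- the bilinear form at a point -/
  form : ∀ x : X, CotangentAt 𝕜 E X x →ₗ[𝕜] CotangentAt 𝕜 E X x →ₗ[𝕜] 𝕜
  form_self : ∀ (x : X) (α : CotangentAt 𝕜 E X x), form x α α = 0

variable {𝕜 E X}

/-- The differential of a function at a point. -/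
def differentialAt (f : X → 𝕜) (x : X) : CotangentAt 𝕜 E X x := mfderiv 𝓘(𝕜, E) 𝓘(𝕜, 𝕜) f x

/-- The bracket `{f, g} = π(df, dg)`. -/
def BivectorField.bracket (π : BivectorField 𝕜 E X) (f g : X → 𝕜) (x : X) : 𝕜 :=
  π.form x (differentialAt f x) (differentialAt g x)

/-- `f` is a smooth (for `𝕜 = ℂ`: holomorphic) function on `U`. -/
def IsSmoothFunOn (𝕜 : Type*) [NontriviallyNormedField 𝕜] (E : Type*) [NormedAddCommGroup E]
    [NormedSpace 𝕜 E] {X : Type*} [TopologicalSpace X] [ChartedSpace E X]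
    (f : X → 𝕜) (U : Set X) : Prop :=
  ContMDiffOn 𝓘(𝕜, E) 𝓘(𝕜, 𝕜) ∞ f U

/-- `π` is a Poisson bivector field: it is smooth (for `𝕜 = ℂ`: holomorphic), and its bracket
satisfies the Jacobi identity on the functions over every open set, which is `[π, π] = 0`.
Antisymmetry and the Leibniz rule hold for every bivector field. For `𝕜 = ℂ` this is a
holomorphic Poisson structure. -/
structure BivectorField.IsPoisson (π : BivectorField 𝕜 E X) : Prop where
  smooth_bracket : ∀ (U : Set X) (f g : X → 𝕜), IsOpen U →
    IsSmoothFunOn 𝕜 E f U → IsSmoothFunOn 𝕜 E g U → IsSmoothFunOn 𝕜 E (π.bracket f g) U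
  jacobi : ∀ (U : Set X) (f g h : X → 𝕜), IsOpen U →
    IsSmoothFunOn 𝕜 E f U → IsSmoothFunOn 𝕜 E g U → IsSmoothFunOn 𝕜 E h U → ∀ x ∈ U,
      π.bracket f (π.bracket g h) x + π.bracket g (π.bracket h f) x
        + π.bracket h (π.bracket f g) x = 0

/-- The characteristic distribution: at `x` it is the image of `π^♯ : T*_x X → T_x X`,
`β (π^♯ α) = π(α, β)`. -/
def BivectorField.distribution (π : BivectorField 𝕜 E X) (x : X) :
    Submodule 𝕜 (TangentSpace 𝓘(𝕜, E) x) where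
  carrier := {v | ∃ α : CotangentAt 𝕜 E X x, ∀ β : CotangentAt 𝕜 E X x, β v = π.form x α β}
  zero_mem' := ⟨0, fun β => by simp⟩
  add_mem' := by
    rintro v w ⟨α, hα⟩ ⟨α', hα'⟩
    exact ⟨α + α', fun β => by simp [hα, hα']⟩
  smul_mem' := by
    rintro c v ⟨α, hα⟩
    exact ⟨c • α, fun β => by simp [hα]⟩

end General

/-- A subset of `X` with a topology of its own. An immersed submanifold is such a pair: its
manifold structure is determined by the subset and the topology. -/
structure TopologizedSubset (X : Type*) where
  /-- the underlying set of points of `X` -/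
  carrier : Set X
  /-- the topology, in general not the subspace topology -/
  topology : TopologicalSpace carrier

namespace TopologizedSubset

variable {X : Type*}

/-- The points of `N`, as a type that carries the topology of `N`. -/
def Point (N : TopologizedSubset X) : Type _ := N.carrier

instance (N : TopologizedSubset X) : TopologicalSpace N.Point := N.topology

/-- The inclusion into `X`. -/
def incl (N : TopologizedSubset X) (p : N.Point) : X := Subtype.val p

end TopologizedSubset

section Leaves

variable {𝕜 : Type*} [NontriviallyNormedField 𝕜]
  {E : Type*} [NormedAddCommGroup E] [NormedSpace 𝕜 E]
  {X : Type*} [TopologicalSpace X] [ChartedSpace E X]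

/-- `N` is an integral manifold of `D`: an immersed submanifold of `X` whose tangent space is `D q`
at each of its points `q`. Each point of `N` has a neighbourhood `V`, open in `N`, that has the
subspace topology of `X` and is a slice `φ ∈ F` of a chart `φ` of `X`; its tangent space at `q`
is then the preimage of `F` under the derivative of `φ`. For `𝕜 = ℂ` the chart is holomorphic and
`F` is a complex subspace, so that `N` is an immersed complex submanifold. -/
def IsIntegralManifold (D : ∀ x : X, Submodule 𝕜 (TangentSpace 𝓘(𝕜, E) x))
    (N : TopologizedSubset X) : Prop :=
  ∀ p : N.Point, ∃ V : Set N.Point, p ∈ V ∧ IsOpen V ∧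
    Topology.IsEmbedding (fun q : V => N.incl q) ∧
    ∃ φ ∈ IsManifold.maximalAtlas 𝓘(𝕜, E) ∞ X, ∃ F : Submodule 𝕜 E,
      N.incl '' V = {x | x ∈ φ.source ∧ φ x ∈ F} ∧
      ∀ q ∈ V, ∀ v : TangentSpace 𝓘(𝕜, E) (N.incl q),
        v ∈ D (N.incl q) ↔ mfderiv 𝓘(𝕜, E) 𝓘(𝕜, E) φ (N.incl q) v ∈ F

/-- A leaf of `D`: a maximal connected integral manifold. Every connected integral manifold
that meets it is an open submanifold of it. -/
structure IsLeaf (D : ∀ x : X, Submodule 𝕜 (TangentSpace 𝓘(𝕜, E) x))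
    (N : TopologizedSubset X) : Prop where
  integral : IsIntegralManifold D N
  connected : ConnectedSpace N.Point
  maximal : ∀ N' : TopologizedSubset X, IsIntegralManifold D N' → ConnectedSpace N'.Point →
    (N.carrier ∩ N'.carrier).Nonempty →
    ∃ j : N'.Point → N.Point, Topology.IsOpenEmbedding j ∧ ∀ q, N.incl (j q) = N'.incl q

/-- The symplectic foliation of a Poisson bivector field: the set of its symplectic leaves, which
are the leaves of the characteristic distribution. For `𝕜 = ℂ` these are the holomorphic
symplectic leaves. -/
def BivectorField.symplecticFoliation (π : BivectorField 𝕜 E X) : Set (TopologizedSubset X) :=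
  {N | IsLeaf π.distribution N}

end Leaves

section RealImaginary

variable {E : Type*} [NormedAddCommGroup E] [NormedSpace ℂ E]
  {X : Type*} [TopologicalSpace X] [ChartedSpace E X]

/-- The restriction to `T^{1,0}_x X` of a complex covector `α` on the real tangent space `T_x X`,
extended complex linearly to `T_x X ⊗ ℂ`. The space `T^{1,0}_x X` is identified with `T_x X`
through `v ↦ (v - i J v) / 2`. -/
def onePart (x : X) (α : TangentSpace 𝓘(ℝ, E) x →L[ℝ] ℂ) : CotangentAt ℂ E X x :=
  let a : E →L[ℝ] ℂ := α
  let l : E →L[ℂ] ℂ :=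
    { toFun := fun v => (a v - Complex.I * a (Complex.I • v)) / 2
      map_add' := fun v w => by simp only [smul_add, map_add]; ring
      map_smul' := fun c v => by
        have h1 : ∀ w : E, a (c • w) = c.re * a w + c.im * a (Complex.I • w) := fun w => by
          have : c • w = c.re • w + c.im • (Complex.I • w) := by
            conv_lhs => rw [← Complex.re_add_im c, add_smul, mul_smul]
            simp
          rw [this]; simp
        have h2 : Complex.I • c • v = c • (Complex.I • v) := smul_comm _ _ _
        rw [h2, h1 v, h1 (Complex.I • v), smul_smul, Complex.I_mul_I, neg_one_smul, map_neg]
        conv_rhs => rw [RingHom.id_apply, smul_eq_mul, ← Complex.re_add_im c]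
        ring_nf
        simp only [Complex.I_sq]
        ring
      cont := by fun_prop }
  l

/-- The value `π(α, β)` on two real covectors of `π`, a section of
`∧² T^{1,0} X ⊆ ∧² (T X ⊗ ℂ)`. -/
def complexValue (π : BivectorField ℂ E X) (x : X) (α β : CotangentAt ℝ E X x) : ℂ :=
  π.form x (onePart x (Complex.ofRealCLM.comp α)) (onePart x (Complex.ofRealCLM.comp β))

theorem onePart_add (x : X) (α β : TangentSpace 𝓘(ℝ, E) x →L[ℝ] ℂ) :
    onePart x (α + β) = onePart x α + onePart x β := by
  apply ContinuousLinearMap.ext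
  intro v
  change (((α v + β v) - Complex.I * (α (Complex.I • (show E from v))
    + β (Complex.I • (show E from v)))) / 2 : ℂ)
    = (α v - Complex.I * α (Complex.I • (show E from v))) / 2
      + (β v - Complex.I * β (Complex.I • (show E from v))) / 2
  ring

theorem onePart_smul (x : X) (c : ℝ) (α : TangentSpace 𝓘(ℝ, E) x →L[ℝ] ℂ) :
    onePart x (c • α) = (c : ℂ) • onePart x α := by
  apply ContinuousLinearMap.ext
  intro v
  change ((c • α v - Complex.I * (c • α (Complex.I • (show E from v)))) / 2 : ℂ)
    = (c : ℂ) * ((α v - Complex.I * α (Complex.I • (show E from v))) / 2)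
  simp only [Complex.real_smul]
  ring

theorem complexValue_add_left (π : BivectorField ℂ E X) (x : X) (α α' β : CotangentAt ℝ E X x) :
    complexValue π x (α + α') β = complexValue π x α β + complexValue π x α' β := by
  simp [complexValue, ContinuousLinearMap.comp_add, onePart_add]

theorem complexValue_add_right (π : BivectorField ℂ E X) (x : X) (α β β' : CotangentAt ℝ E X x) :
    complexValue π x α (β + β') = complexValue π x α β + complexValue π x α β' := by
  simp [complexValue, ContinuousLinearMap.comp_add, onePart_add]

theorem complexValue_smul_left (π : BivectorField ℂ E X) (x : X) (c : ℝ)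
    (α β : CotangentAt ℝ E X x) :
    complexValue π x (c • α) β = c * complexValue π x α β := by
  simp [complexValue, onePart_smul]

theorem complexValue_smul_right (π : BivectorField ℂ E X) (x : X) (c : ℝ)
    (α β : CotangentAt ℝ E X x) :
    complexValue π x α (c • β) = c * complexValue π x α β := by
  simp [complexValue, onePart_smul]

/-- The real part `π_R`, a bivector field on the underlying real manifold. -/
def BivectorField.realPart (π : BivectorField ℂ E X) : BivectorField ℝ E X where
  form x := LinearMap.mk₂ ℝ (fun α β => (complexValue π x α β).re)
    (fun α α' β => by simp [complexValue_add_left])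
    (fun c α β => by simp [complexValue_smul_left])
    (fun α β β' => by simp [complexValue_add_right])
    (fun c α β => by simp [complexValue_smul_right])
  form_self x α := by simp [complexValue, π.form_self]

/-- The imaginary part `π_I`, a bivector field on the underlying real manifold. -/
def BivectorField.imaginaryPart (π : BivectorField ℂ E X) : BivectorField ℝ E X where
  form x := LinearMap.mk₂ ℝ (fun α β => (complexValue π x α β).im)
    (fun α α' β => by simp [complexValue_add_left])
    (fun c α β => by simp [complexValue_smul_left])
    (fun α β β' => by simp [complexValue_add_right])
    (fun c α β => by simp [complexValue_smul_right])
  form_self x α := by simp [complexValue, π.form_self]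

end RealImaginary

end

/-! For a real covector `a`, write `a'` for its (1,0)-part, which satisfies `Re a' = a/2`. The map
`a ↦ a'` is a real linear bijection onto complex covectors, and comparing real parts gives `π_R^♯ a
= ½ π^♯ a'`. So `π_R` and `π` have the same characteristic distribution. Since `π_I` is the real
part of `-iπ`, and a nonzero scalar does not change the image of `π^♯`, the same distribution
belongs to `π_I` (`mem_realPart_distribution_iff`, `distribution_scale`).

Equality of the foliations is then a statement about integral manifolds: a smooth integral manifold
of a complex distribution is a complex submanifold. Locally it is a graph over one of its tangent
spaces `T`. Invariance of all tangent spaces under `I` makes the graph map holomorphic, and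
subtracting it from the identity is a holomorphic shear that flattens the graph onto `T`
(`exists_holomorphic_straightening`). The topology of the submanifold plays no part in this, so
maximality transfers too.

For the Jacobi identity, the second derivatives in the cyclic sum cancel by symmetry of Hessians, so
linear functions of charts suffice (`isPoisson_of_linear`). These are real parts of holomorphic
functions, for which `{Re f, Re g}_R = Re(¼ {f, g})`; the identity for `π_R` is therefore the real
part of the one for `π`. -/

/-! ### Complex differentiability and smoothness -/

section ComplexSmooth

variable {E : Type*} [NormedAddCommGroup E] [NormedSpace ℂ E]
  {F : Type*} [NormedAddCommGroup F] [NormedSpace ℂ F]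

theorem Complex.smul_eq_re_smul_add_im_smul (c : ℂ) (w : E) :
    c • w = c.re • w + c.im • (Complex.I • w) := by
  conv_lhs => rw [← Complex.re_add_im c, add_smul, mul_smul]
  simp

/-- A real continuous linear map that commutes with `I`, as a complex linear map. -/
noncomputable def ContinuousLinearMap.toComplexLinear (A : E →L[ℝ] F)
    (hA : ∀ w, A (Complex.I • w) = Complex.I • A w) : E →L[ℂ] F where
  toFun := A
  map_add' := A.map_add
  map_smul' c w := by
    rw [RingHom.id_apply, Complex.smul_eq_re_smul_add_im_smul,
      Complex.smul_eq_re_smul_add_im_smul c (A w)]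
    simp [hA]
  cont := A.continuous

theorem HasFDerivAt.toComplexLinear {f : E → F} {A : E →L[ℝ] F} {x : E} (hf : HasFDerivAt f A x)
    (hA : ∀ w, A (Complex.I • w) = Complex.I • A w) :
    HasFDerivAt f (A.toComplexLinear hA) x :=
  hasFDerivAt_of_restrictScalars ℝ hf rfl

theorem DifferentiableAt.fderiv_real_apply {f : E → F} {x : E} (hf : DifferentiableAt ℂ f x)
    (w : E) : fderiv ℝ f x w = fderiv ℂ f x w := by
  rw [hf.fderiv_restrictScalars ℝ]; rfl

/-- A smooth function of real variables that is complex differentiable is smooth over `ℂ`. -/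
theorem ContDiffOn.complex_of_real [FiniteDimensional ℂ E] {f : E → F} {U : Set E}
    (hU : IsOpen U) (hf : ContDiffOn ℝ ∞ f U) (hd : DifferentiableOn ℂ f U) :
    ContDiffOn ℂ ∞ f U := by
  refine contDiffOn_infty.2 fun n => ?_
  -- `f` varies because the induction hypothesis is applied to the directional derivatives of `f`.
  induction n generalizing f with
  | zero => exact contDiffOn_zero.2 hd.continuousOn
  | succ n ih =>
    have : FiniteDimensional ℝ E := FiniteDimensional.complexToReal E
    push_cast
    refine (contDiffOn_succ_iff_fderiv_of_isOpen hU).2 ⟨hd, by simp, ?_⟩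
    refine contDiffOn_clm_apply.2 fun y => ?_
    have key : ∀ z ∈ U, ∀ v, fderiv ℂ f z v = fderiv ℝ f z v := fun z hz v =>
      ((hd.differentiableAt (hU.mem_nhds hz)).fderiv_real_apply v).symm
    have hf' : ContDiffOn ℝ ∞ (fderiv ℝ f) U := hf.fderiv_of_isOpen hU (by simp)
    have hfy : ∀ v, ContDiffOn ℝ ∞ (fun z => fderiv ℝ f z v) U := contDiffOn_clm_apply.1 hf'
    refine ContDiffOn.congr (ih (hfy y) fun z hz => ?_) fun z hz => key z hz y
    have hz' := hU.mem_nhds hz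
    have hsym : IsSymmSndFDerivAt ℝ f z :=
      (hf.contDiffAt hz').isSymmSndFDerivAt (by simp; exact WithTop.coe_le_coe.2 (le_top (a := (2 : ℕ∞))))
    have hD : DifferentiableAt ℝ (fderiv ℝ f) z :=
      (hf'.contDiffAt hz').differentiableAt (by simp)
    have happ : ∀ v w, fderiv ℝ (fun z => fderiv ℝ f z v) z w = fderiv ℝ (fderiv ℝ f) z w v := by
      intro v w
      rw [fderiv_clm_apply hD (by fun_prop)]
      simp
    have hv : DifferentiableAt ℝ (fun z => fderiv ℝ f z y) z :=
      ((hfy y).contDiffAt hz').differentiableAt (by simp)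
    refine (hv.hasFDerivAt.toComplexLinear fun w => ?_).differentiableAt
      |>.differentiableWithinAt
    -- Symmetry of the second derivative moves `Complex.I • w` into the inner slot, where complex
    -- linearity of the first derivative of `f` takes the factor out.
    rw [happ, happ, hsym.eq, hsym.eq w y, ← happ, ← happ]
    have hw : DifferentiableAt ℝ (fun z => fderiv ℝ f z w) z :=
      ((hfy w).contDiffAt hz').differentiableAt (by simp)
    have : (fun z => fderiv ℝ f z (Complex.I • w)) =ᶠ[𝓝 z]
        fun z => Complex.I • fderiv ℝ f z w := by
      filter_upwards [hz'] with u hu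
      rw [← key u hu, ← key u hu, map_smul]
    rw [this.fderiv_eq, fderiv_fun_const_smul hw]
    rfl

end ComplexSmooth

/-! ### Straightening a slice with complex tangent spaces -/

section Straighten

variable {E : Type*} [NormedAddCommGroup E] [NormedSpace ℂ E]

/-- The preimage of a real subspace under a real linear map, as a complex subspace if it is
invariant under `I`. -/
def Submodule.complexComap (F : Submodule ℝ E) (L : E →L[ℝ] E)
    (h : ∀ w, L w ∈ F → L (Complex.I • w) ∈ F) : Submodule ℂ E where
  carrier := {w | L w ∈ F}
  zero_mem' := by simp
  add_mem' {v w} hv hw := by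
    simp only [Set.mem_ofPred_eq, map_add] at *
    exact F.add_mem hv hw
  smul_mem' c w hw := by
    simp only [Set.mem_ofPred_eq] at *
    rw [Complex.smul_eq_re_smul_add_im_smul, map_add, map_smul, map_smul]
    exact F.add_mem (F.smul_mem _ hw) (F.smul_mem _ (h w hw))

/-- The shear `e ↦ e - g e`, where `g` depends on `e` only modulo its values. -/
def OpenPartialHomeomorph.shear (g : E → E) (P : Set E) (hP : IsOpen P) (hg : ContinuousOn g P)
    (hgP : ∀ e v, e ∈ P → e + g v ∈ P ∧ e - g v ∈ P)
    (hgg : ∀ e v, g (e + g v) = g e ∧ g (e - g v) = g e) : OpenPartialHomeomorph E E where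
  toFun e := e - g e
  invFun e := e + g e
  source := P
  target := P
  map_source' e he := (hgP e e he).2
  map_target' e he := (hgP e e he).1
  left_inv' e _ := by simp [(hgg e e).2]
  right_inv' e _ := by simp [(hgg e e).1]
  open_source := hP
  open_target := hP
  continuousOn_toFun := continuousOn_id.sub hg
  continuousOn_invFun := continuousOn_id.add hg

/-- If the tangent spaces of a real slice `χ e ∈ F` are complex subspaces, then the slice is locally
a slice of a holomorphic chart. -/
theorem exists_holomorphic_straightening [FiniteDimensional ℂ E] {O : Set E} (hO : IsOpen O)
    {e₀ : E} (he₀ : e₀ ∈ O) {χ : E → E} (hχ : ContDiffOn ℝ ∞ χ O) (F : Submodule ℝ E)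
    (h₀ : χ e₀ ∈ F) (L : E ≃L[ℝ] E) (hL : HasFDerivAt χ (L : E →L[ℝ] E) e₀)
    (hF : ∀ e ∈ O, χ e ∈ F → ∀ w, fderiv ℝ χ e w ∈ F → fderiv ℝ χ e (Complex.I • w) ∈ F) :
    ∃ (ψ : OpenPartialHomeomorph E E) (T : Submodule ℂ E), e₀ ∈ ψ.source ∧ ψ.source ⊆ O ∧
      ContDiffOn ℂ ∞ ψ ψ.source ∧ ContDiffOn ℂ ∞ ψ.symm ψ.target ∧
      ∀ e ∈ ψ.source, (χ e ∈ F ↔ ψ e ∈ T) ∧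
        (χ e ∈ F → ∀ w, fderiv ℝ χ e w ∈ F ↔ fderiv ℂ ψ e w ∈ T) := by
  have hfin : FiniteDimensional ℝ E := FiniteDimensional.complexToReal E
  have hcompl : CompleteSpace E := FiniteDimensional.complete ℂ E
  -- `T` is the tangent space of the slice at `e₀`; it is complex by `hF`.
  let T : Submodule ℂ E := F.complexComap (L : E →L[ℝ] E) (by
    have := hF e₀ he₀ h₀
    rwa [hL.fderiv] at this)
  have hT : ∀ w, w ∈ T ↔ L w ∈ F := fun w => Iff.rfl
  obtain ⟨p, hp⟩ : T.ClosedComplemented := .of_finiteDimensional T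
  let pr : E →L[ℂ] E := T.subtypeL.comp p
  have pr_mem : ∀ w, pr w ∈ T := fun w => (p w).2
  have pr_of_mem : ∀ w ∈ T, pr w = w := fun w hw => congrArg Subtype.val (hp ⟨w, hw⟩)
  have pr_pr : ∀ w, pr (pr w) = pr w := fun w => pr_of_mem _ (pr_mem w)
  let q : E →L[ℂ] E := ContinuousLinearMap.id ℂ E - pr
  have q_apply : ∀ w, q w = w - pr w := fun w => rfl
  have q_eq_zero : ∀ w, q w = 0 ↔ w ∈ T := fun w => by
    rw [q_apply, sub_eq_zero]
    exact ⟨fun h => h ▸ pr_mem w, fun h => (pr_of_mem w h).symm⟩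
  have pr_q : ∀ w, pr (q w) = 0 := fun w => by rw [q_apply, map_sub, pr_pr, sub_self]
  have q_pr : ∀ w, q (pr w) = 0 := fun w => by rw [q_apply, pr_pr, sub_self]
  have q_q : ∀ w, q (q w) = q w := fun w => by rw [q_apply (q w), pr_q, sub_zero]
  have qL : ∀ u, q (L.symm u) = 0 ↔ u ∈ F := fun u => by
    rw [q_eq_zero, hT, L.apply_symm_apply]
  let prR : E →L[ℝ] E := pr.restrictScalars ℝ
  -- The kernel of `k` is `F`, so the slice is the set where `Ψ e = pr e`.
  let k : E →L[ℝ] E := (q.restrictScalars ℝ).comp (L.symm : E →L[ℝ] E)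
  have k_apply : ∀ u, k u = q (L.symm u) := fun u => rfl
  let Ψ : E → E := fun e => prR e + k (χ e)
  have Ψ_apply : ∀ e, Ψ e = pr e + q (L.symm (χ e)) := fun e => rfl
  have hΨ : ContDiffOn ℝ ∞ Ψ O :=
    prR.contDiff.contDiffOn.add (k.contDiff.comp_contDiffOn hχ)
  have hχd : ∀ e ∈ O, HasFDerivAt χ (fderiv ℝ χ e) e := fun e he =>
    ((hχ.contDiffAt (hO.mem_nhds he)).differentiableAt (by simp)).hasFDerivAt
  have hΨd : ∀ e ∈ O, HasFDerivAt Ψ (prR + k.comp (fderiv ℝ χ e)) e := fun e he =>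
    prR.hasFDerivAt.add (k.hasFDerivAt.comp e (hχd e he))
  -- `L.symm` in `k` cancels the derivative of `χ` at `e₀`, leaving `pr + q = id`; hence `Ψ` is
  -- locally invertible.
  have hΨ₀ : HasFDerivAt Ψ ((ContinuousLinearEquiv.refl ℝ E : E ≃L[ℝ] E) : E →L[ℝ] E) e₀ := by
    convert hΨd e₀ he₀ using 1
    ext w
    simp [hL.fderiv, k_apply, prR, q_apply]
  have hΨc := hΨ.contDiffAt (hO.mem_nhds he₀)
  let H : OpenPartialHomeomorph E E := hΨc.toOpenPartialHomeomorph Ψ hΨ₀ (by simp)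
  have H_coe : ∀ e, H e = Ψ e := fun e => rfl
  have H_mem : e₀ ∈ H.source := hΨc.mem_toOpenPartialHomeomorph_source hΨ₀ (by simp)
  let Ω : Set E := O ∩ fderiv ℝ Ψ ⁻¹' Set.range ContinuousLinearEquiv.toContinuousLinearMap
  have hΩ : IsOpen Ω := (hΨ.continuousOn_fderiv_of_isOpen hO (by simp)).isOpen_inter_preimage hO
    ContinuousLinearEquiv.isOpen
  have hΩd : ∀ e ∈ Ω, ∃ M : E ≃L[ℝ] E, HasFDerivAt Ψ (M : E →L[ℝ] E) e ∧
      ∀ w, M w = pr w + q (L.symm (fderiv ℝ χ e w)) := by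
    rintro e ⟨he, M, hM⟩
    have h := hΨd e he
    refine ⟨M, ?_, fun w => ?_⟩
    · rw [hM]; exact h.differentiableAt.hasFDerivAt
    · have := congrArg (fun A : E →L[ℝ] E => A w) (hM.trans h.fderiv)
      exact this
  let P : Set E := pr ⁻¹' (H.target ∩ H.symm ⁻¹' Ω)
  have hP : IsOpen P := (H.symm.isOpen_inter_preimage hΩ).preimage pr.continuous
  -- `G e` is the point of the slice above `pr e`, so `G` parametrizes the slice as a graph over
  -- `T`.
  let G : E → E := fun e => H.symm (pr e)
  have Ψ_G : ∀ e ∈ P, Ψ (G e) = pr e := fun e he => H.right_inv he.1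
  have pr_G : ∀ e ∈ P, pr (G e) = pr e := fun e he => by
    have := congrArg pr (Ψ_G e he)
    rwa [Ψ_apply, map_add, pr_q, add_zero, pr_pr, pr_pr] at this
  have χ_G : ∀ e ∈ P, χ (G e) ∈ F := fun e he => by
    have := congrArg q (Ψ_G e he)
    rwa [Ψ_apply, map_add, q_pr, q_pr, zero_add, q_q, qL] at this
  have hGd : ∀ e ∈ P, ∃ M : E ≃L[ℝ] E, HasFDerivAt Ψ (M : E →L[ℝ] E) (G e) ∧
      (∀ w, M w = pr w + q (L.symm (fderiv ℝ χ (G e) w))) ∧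
      HasFDerivAt G ((M.symm : E →L[ℝ] E).comp prR) e := by
    intro e he
    obtain ⟨M, hM, hM'⟩ := hΩd (G e) he.2
    exact ⟨M, hM, hM', (H.hasFDerivAt_symm he.1 hM).comp e prR.hasFDerivAt⟩
  have pr_M : ∀ e w, ∀ M : E ≃L[ℝ] E, (∀ w, M w = pr w + q (L.symm (fderiv ℝ χ e w))) →
      pr (M.symm (pr w)) = pr w := by
    intro e w M hM
    have := congrArg pr ((hM (M.symm (pr w))).symm.trans (M.apply_symm_apply _))
    rwa [map_add, pr_q, add_zero, pr_pr, pr_pr] at this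
  have hGR : ContDiffOn ℝ ∞ G P := by
    intro e he
    obtain ⟨M, hM, -⟩ := hGd e he
    have h1 : ContDiffAt ℝ ∞ H.symm (pr e) := H.contDiffAt_symm he.1 hM
      (hΨ.contDiffAt (hO.mem_nhds he.2.1))
    exact (h1.comp e prR.contDiff.contDiffAt).contDiffWithinAt
  -- The derivative of `G` sends `w` to the vector tangent to the slice with projection `pr w`.
  -- Multiplying that vector by `I` keeps it tangent, so it is the vector lying over `I • pr w`.
  have hGC : DifferentiableOn ℂ G P := by
    intro e he
    obtain ⟨M, -, hM, hG⟩ := hGd e he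
    refine (hG.toComplexLinear fun w => ?_).differentiableAt.differentiableWithinAt
    change M.symm (pr (Complex.I • w)) = Complex.I • M.symm (pr w)
    rw [M.symm_apply_eq, hM]
    have h1 := (hM (M.symm (pr w))).symm.trans (M.apply_symm_apply _)
    have h2 := congrArg q h1
    rw [map_add, q_pr, q_pr, zero_add, q_q, qL] at h2
    have h3 := hF (G e) he.2.1 (χ_G e he) _ h2
    rw [(qL _).2 h3, add_zero, map_smul, map_smul, pr_M _ w M hM]
  have hG : ContDiffOn ℂ ∞ G P := hGR.complex_of_real hP hGC
  -- `g` is the height of the graph. It depends on `e` only through `pr e` and has values in the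
  -- kernel of `pr`, which is what makes the shear invertible.
  let g : E → E := fun e => q (G e)
  have hg : ContDiffOn ℂ ∞ g P := q.contDiff.comp_contDiffOn hG
  have pr_add : ∀ e v, pr (e + g v) = pr e ∧ pr (e - g v) = pr e := fun e v => by
    simp only [g, map_add, map_sub, pr_q, add_zero, sub_zero, and_self]
  let ψ₀ : OpenPartialHomeomorph E E := OpenPartialHomeomorph.shear g P hP hg.continuousOn
    (fun e v he => by
      simp only [P, Set.mem_preimage, (pr_add e v).1, (pr_add e v).2] at he ⊢
      exact ⟨he, he⟩)
    (fun e v => by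
      change q (H.symm (pr (e + g v))) = _ ∧ q (H.symm (pr (e - g v))) = _
      rw [(pr_add e v).1, (pr_add e v).2]
      exact ⟨rfl, rfl⟩)
  let S : Set E := O ∩ H.source
  have hS : IsOpen S := hO.inter H.open_source
  have he₀Ψ : Ψ e₀ = pr e₀ := by rw [Ψ_apply, (qL _).2 h₀, add_zero]
  have he₀P : e₀ ∈ P := by
    have h1 : H.symm (pr e₀) = e₀ := by rw [← he₀Ψ]; exact H.left_inv H_mem
    refine ⟨by rw [← he₀Ψ]; exact H.map_source H_mem, ?_⟩
    rw [Set.mem_preimage, h1]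
    exact ⟨he₀, _, hΨ₀.fderiv.symm⟩
  refine ⟨ψ₀.restrOpen S hS, T, ⟨he₀P, he₀, H_mem⟩, fun e he => he.2.1, ?_, ?_, ?_⟩
  · exact (contDiffOn_id.sub hg).mono fun e he => he.1
  · exact (contDiffOn_id.add hg).mono fun e he => he.1
  rintro e ⟨heP, heO, heH⟩
  replace heP : e ∈ P := heP
  -- Near `e₀` the slice is the fixed point set of `G`; `e` and `G e` share their `pr`-component, so
  -- only the `q`-components need comparing.
  have key : χ e ∈ F ↔ G e = e := by
    rw [← qL]
    constructor
    · intro h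
      have : H e = pr e := by rw [H_coe, Ψ_apply, h, add_zero]
      change H.symm (pr e) = e
      rw [← this, H.left_inv heH]
    · intro h
      rw [qL, ← h]
      exact χ_G e heP
  have hψ : ∀ e, (ψ₀.restrOpen S hS) e = e - q (G e) := fun e => rfl
  refine ⟨?_, fun hχe w => ?_⟩
  · rw [key, hψ, ← q_eq_zero, map_sub, q_q, sub_eq_zero, q_apply, q_apply, pr_G e heP]
    exact ⟨fun h => by rw [h], fun h => (sub_left_injective h).symm⟩
  -- Infinitesimal version of `key`: `w` is tangent to the slice exactly when `M w = pr w`, that is,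
  -- when the derivative of `G` fixes `w`.
  · obtain ⟨M, -, hM, hMG⟩ := hGd e heP
    have hd := hGC.differentiableAt (hP.mem_nhds heP)
    have hDG : fderiv ℂ G e w = M.symm (pr w) := by
      rw [← hd.fderiv_real_apply, hMG.fderiv]; rfl
    have hDψ : fderiv ℂ (ψ₀.restrOpen S hS) e w = w - q (M.symm (pr w)) := by
      have : HasFDerivAt (ψ₀.restrOpen S hS)
          (ContinuousLinearMap.id ℂ E - q.comp (fderiv ℂ G e)) e :=
        (hasFDerivAt_id e).sub (q.hasFDerivAt.comp e hd.hasFDerivAt)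
      rw [this.fderiv, ← hDG]; rfl
    rw [key.1 hχe] at hM
    rw [hDψ, ← q_eq_zero, map_sub, q_q, sub_eq_zero, q_apply, q_apply, pr_M e w M hM,
      sub_left_inj, ← qL, eq_comm (a := w), M.symm_apply_eq, hM w]
    simp
end Straighten

/-! ### Real and complex derivatives on a complex manifold -/

section ModelDeriv

variable (𝕜 : Type*) [NontriviallyNormedField 𝕜] {E : Type*} [NormedAddCommGroup E]
  [NormedSpace 𝕜 E] {F : Type*} [NormedAddCommGroup F] [NormedSpace 𝕜 F]
  {X : Type*} [TopologicalSpace X] [ChartedSpace E X]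

/-- The manifold derivative of a vector valued function, as a linear map on the model space. -/
noncomputable def modelDeriv (f : X → F) (x : X) : E →L[𝕜] F := mfderiv 𝓘(𝕜, E) 𝓘(𝕜, F) f x

end ModelDeriv

section RealManifold

variable {E : Type*} [NormedAddCommGroup E] [NormedSpace ℂ E]
  {F : Type*} [NormedAddCommGroup F] [NormedSpace ℂ F]
  {X : Type*} [TopologicalSpace X] [ChartedSpace E X]

theorem contDiffGroupoid_complex_le_real :
    contDiffGroupoid ∞ 𝓘(ℂ, E) ≤ contDiffGroupoid ∞ 𝓘(ℝ, E) := by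
  intro e he
  have he' := mem_groupoid_of_pregroupoid.1 he
  exact mem_groupoid_of_pregroupoid.2
    ⟨ContDiffOn.restrict_scalars ℝ he'.1, ContDiffOn.restrict_scalars ℝ he'.2⟩

theorem isManifold_real_of_complex [IsManifold 𝓘(ℂ, E) ∞ X] : IsManifold 𝓘(ℝ, E) ∞ X :=
  { compatible := fun he he' => contDiffGroupoid_complex_le_real
      (StructureGroupoid.compatible (contDiffGroupoid ∞ 𝓘(ℂ, E)) he he') }

theorem maximalAtlas_complex_subset_real :
    IsManifold.maximalAtlas 𝓘(ℂ, E) ∞ X ⊆ IsManifold.maximalAtlas 𝓘(ℝ, E) ∞ X :=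
  StructureGroupoid.maximalAtlas_mono contDiffGroupoid_complex_le_real

/-- The charts are the same over both fields, so the local expression is the same map and only the
scalars of its derivative are restricted. -/
theorem MDifferentiableAt.hasMFDerivAt_real {f : X → F} {x : X}
    (hf : MDifferentiableAt 𝓘(ℂ, E) 𝓘(ℂ, F) f x) :
    HasMFDerivAt 𝓘(ℝ, E) 𝓘(ℝ, F) f x ((modelDeriv ℂ f x).restrictScalars ℝ : E →L[ℝ] F) := by
  have h := hf.hasMFDerivAt
  have h' : HasFDerivWithinAt (writtenInExtChartAt 𝓘(ℂ, E) 𝓘(ℂ, F) x f)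
      (modelDeriv ℂ f x) (Set.range 𝓘(ℂ, E)) (extChartAt 𝓘(ℂ, E) x x) := h.2
  exact ⟨h.1, h'.restrictScalars ℝ⟩

theorem MDifferentiableAt.modelDeriv_real_apply {f : X → F} {x : X}
    (hf : MDifferentiableAt 𝓘(ℂ, E) 𝓘(ℂ, F) f x) (v : E) :
    modelDeriv ℝ f x v = modelDeriv ℂ f x v := by
  rw [modelDeriv, hf.hasMFDerivAt_real.mfderiv]
  rfl

section Charts

variable {𝕜 : Type*} [NontriviallyNormedField 𝕜] {E : Type*} [NormedAddCommGroup E]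
  [NormedSpace 𝕜 E] {F : Type*} [NormedAddCommGroup F] [NormedSpace 𝕜 F]
  {X : Type*} [TopologicalSpace X] [ChartedSpace E X]

theorem mdifferentiable_of_mem_maximalAtlas [IsManifold 𝓘(𝕜, E) ∞ X]
    {φ : OpenPartialHomeomorph X E}
    (hφ : φ ∈ IsManifold.maximalAtlas 𝓘(𝕜, E) ∞ X) : φ.MDifferentiable 𝓘(𝕜, E) 𝓘(𝕜, E) :=
  ⟨(contMDiffOn_of_mem_maximalAtlas hφ).mdifferentiableOn (by simp),
    (contMDiffOn_symm_of_mem_maximalAtlas hφ).mdifferentiableOn (by simp)⟩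

theorem modelDeriv_comp_chart {κ : OpenPartialHomeomorph X E}
    (hκ : κ.MDifferentiable 𝓘(𝕜, E) 𝓘(𝕜, E)) {g : E → F} {f : X → F} {x : X}
    (hx : x ∈ κ.source) (hg : DifferentiableAt 𝕜 g (κ x)) (h : f =ᶠ[𝓝 x] g ∘ κ) (v : E) :
    modelDeriv 𝕜 f x v = fderiv 𝕜 g (κ x) (modelDeriv 𝕜 κ x v) := by
  rw [modelDeriv, h.mfderiv_eq, mfderiv_comp x hg.mdifferentiableAt (hκ.mdifferentiableAt hx), mfderiv_eq_fderiv]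
  rfl

end Charts

end RealManifold

/-! ### Real and complex integral manifolds -/

section IntegralManifolds

variable {E : Type*} [NormedAddCommGroup E] [NormedSpace ℂ E]
  {X : Type*} [TopologicalSpace X] [ChartedSpace E X] [IsManifold 𝓘(ℂ, E) ∞ X]
  {D : ∀ x : X, Submodule ℂ (TangentSpace 𝓘(ℂ, E) x)}
  {D' : ∀ x : X, Submodule ℝ (TangentSpace 𝓘(ℝ, E) x)}

/-- A holomorphic chart is a smooth chart with the same derivative, so the same slices serve. -/
theorem IsIntegralManifold.real_of_complex
    (hD : ∀ (x : X) (v : E), v ∈ (D' x : Submodule ℝ E) ↔ v ∈ (D x : Submodule ℂ E))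
    {N : TopologizedSubset X} (hN : IsIntegralManifold D N) : IsIntegralManifold D' N := by
  intro p
  obtain ⟨V, hpV, hV, hemb, φ, hφ, F, himg, htan⟩ := hN p
  refine ⟨V, hpV, hV, hemb, φ, maximalAtlas_complex_subset_real hφ, F.restrictScalars ℝ, himg,
    fun q hq v => ?_⟩
  have hq' : N.incl q ∈ φ.source := by
    have : N.incl q ∈ N.incl '' V := ⟨q, hq, rfl⟩
    rw [himg] at this
    exact this.1
  refine (hD (N.incl q) v).trans ((htan q hq v).trans ?_)
  have := ((mdifferentiable_of_mem_maximalAtlas hφ).mdifferentiableAt hq').modelDeriv_real_apply v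
  exact iff_of_eq (congrArg (fun w : E => w ∈ F) this.symm)

/-- The smooth slice chart, read in a holomorphic chart `κ`, is a map `C` whose slice has complex
tangent spaces because `D` is complex. Straightening it by a holomorphic `ψ` yields the holomorphic
slice chart `κ.trans ψ`. -/
theorem IsIntegralManifold.complex_of_real [FiniteDimensional ℂ E]
    (hD : ∀ (x : X) (v : E), v ∈ (D' x : Submodule ℝ E) ↔ v ∈ (D x : Submodule ℂ E))
    {N : TopologizedSubset X} (hN : IsIntegralManifold D' N) : IsIntegralManifold D N := by
  intro p
  have : IsManifold 𝓘(ℝ, E) ∞ X := isManifold_real_of_complex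
  obtain ⟨V, hpV, hV, hemb, φ, hφ, F, himg, htan⟩ := hN p
  have hmem : ∀ q ∈ V, N.incl q ∈ φ.source ∧ φ (N.incl q) ∈ F := fun q hq => by
    have : N.incl q ∈ N.incl '' V := ⟨q, hq, rfl⟩
    rwa [himg] at this
  have htan' : ∀ x ∈ φ.source, φ x ∈ F → ∀ v : E, v ∈ (D x : Submodule ℂ E) ↔
      modelDeriv ℝ φ x v ∈ F := by
    intro x hx hxF v
    obtain ⟨q, hq, rfl⟩ : x ∈ N.incl '' V := by rw [himg]; exact ⟨hx, hxF⟩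
    exact (hD _ v).symm.trans (htan q hq v)
  let κ : OpenPartialHomeomorph X E := chartAt E (N.incl p)
  have hκC : κ ∈ IsManifold.maximalAtlas 𝓘(ℂ, E) ∞ X := IsManifold.chart_mem_maximalAtlas _
  have hκR : κ ∈ IsManifold.maximalAtlas 𝓘(ℝ, E) ∞ X := IsManifold.chart_mem_maximalAtlas _
  have dκC := mdifferentiable_of_mem_maximalAtlas hκC
  have dκR := mdifferentiable_of_mem_maximalAtlas hκR
  have dφ := mdifferentiable_of_mem_maximalAtlas hφ
  have hpκ : N.incl p ∈ κ.source := mem_chart_source E _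
  let C : OpenPartialHomeomorph E E := κ.symm.trans φ
  have hC : ContDiffOn ℝ ∞ C C.source :=
    ((contMDiffOn_of_mem_maximalAtlas hφ).comp
      ((contMDiffOn_symm_of_mem_maximalAtlas hκR).mono fun e he => he.1)
      fun e he => he.2).contDiffOn
  have dC : C.MDifferentiable 𝓘(ℝ, E) 𝓘(ℝ, E) := dκR.symm.trans dφ
  have hCd : ∀ e ∈ C.source, DifferentiableAt ℝ C e := fun e he =>
    (hC.contDiffAt (C.open_source.mem_nhds he)).differentiableAt (by simp)
  have memC : ∀ x ∈ κ.source, x ∈ φ.source → κ x ∈ C.source ∧ C (κ x) = φ x := by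
    intro x hx hx'
    refine ⟨⟨κ.map_source hx, ?_⟩, ?_⟩
    · change κ.symm (κ x) ∈ φ.source
      rwa [κ.left_inv hx]
    · exact congrArg φ (κ.left_inv hx)
  have chain : ∀ x ∈ κ.source, x ∈ φ.source → ∀ v : E,
      modelDeriv ℝ φ x v
        = fderiv ℝ C (κ x) (modelDeriv ℂ κ x v) := by
    intro x hx hx' v
    rw [← (dκC.mdifferentiableAt hx).modelDeriv_real_apply v]
    refine modelDeriv_comp_chart dκR hx (hCd _ (memC x hx hx').1) ?_ v
    filter_upwards [κ.open_source.mem_nhds hx, φ.open_source.mem_nhds hx'] with y hy hy'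
    exact (memC y hy hy').2.symm
  have hp := hmem p hpV
  have h₀ := memC _ hpκ hp.1
  have hFC : ∀ e ∈ C.source, C e ∈ F → ∀ w, fderiv ℝ C e w ∈ F →
      fderiv ℝ C e (Complex.I • w) ∈ F := by
    intro e he heF w hw
    obtain ⟨x, hx, rfl⟩ : ∃ x ∈ κ.source, κ x = e :=
      ⟨κ.symm e, κ.map_target he.1, κ.right_inv he.1⟩
    have hx' : x ∈ φ.source := by
      have : κ.symm (κ x) ∈ φ.source := he.2
      rwa [κ.left_inv hx] at this
    obtain ⟨v, rfl⟩ : ∃ v : E, modelDeriv ℂ κ x v = w := (dκC.mfderiv_bijective hx).2 w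
    have hxF : φ x ∈ F := (memC x hx hx').2 ▸ heF
    have h1 := (htan' x hx' hxF v).2 (by rw [chain x hx hx']; exact hw)
    have h2 := (htan' x hx' hxF (Complex.I • v)).1 ((D x).smul_mem Complex.I h1)
    rw [chain x hx hx', map_smul] at h2
    exact h2
  obtain ⟨ψ, T, heψ, hψC, hψ, hψs, key⟩ := exists_holomorphic_straightening C.open_source h₀.1 hC F
    (by rw [h₀.2]; exact hp.2) (dC.mfderiv h₀.1)
    (by
      have := (hCd _ h₀.1).hasFDerivAt
      rw [← mfderiv_eq_fderiv] at this
      exact this) hFC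
  let φ' : OpenPartialHomeomorph X E := κ.trans ψ
  have hφ' : φ' ∈ IsManifold.maximalAtlas 𝓘(ℂ, E) ∞ X := by
    refine φ'.mem_maximalAtlas_of_contMDiffOn ?_ ?_
    · exact hψ.contMDiffOn.comp ((contMDiffOn_of_mem_maximalAtlas hκC).mono fun x hx => hx.1)
        fun x hx => hx.2
    · exact (contMDiffOn_symm_of_mem_maximalAtlas hκC).comp (hψs.contMDiffOn.mono fun x hx => hx.1)
        fun x hx => hx.2
  have hsource : ∀ x ∈ φ'.source, x ∈ κ.source ∧ x ∈ φ.source ∧ κ x ∈ ψ.source := by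
    intro x hx
    have h1 : x ∈ κ.source := hx.1
    have h2 : κ x ∈ ψ.source := hx.2
    refine ⟨h1, ?_, h2⟩
    have h3 : κ.symm (κ x) ∈ φ.source := (hψC h2).2
    rwa [κ.left_inv h1] at h3
  have hslice : ∀ x ∈ φ'.source, (φ x ∈ F ↔ φ' x ∈ T) := by
    intro x hx
    obtain ⟨h1, h2, h3⟩ := hsource x hx
    rw [← (memC x h1 h2).2]
    exact (key _ h3).1
  -- The straightened chart may have a smaller domain, so the neighbourhood shrinks with it.
  let V' : Set N.Point := {q | q ∈ V ∧ N.incl q ∈ φ'.source}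
  have hV'V : V' ⊆ V := fun q hq => hq.1
  refine ⟨V', ⟨hpV, hpκ, heψ⟩, ?_, hemb.comp (Topology.IsEmbedding.inclusion hV'V), φ', hφ', T, ?_,
    ?_⟩
  · have h := hV.isOpenEmbedding_subtypeVal.isOpenMap _
      (φ'.open_source.preimage hemb.continuous)
    convert h using 1
    ext q
    exact ⟨fun hq => ⟨⟨q, hq.1⟩, hq.2, rfl⟩, by rintro ⟨q, hq, rfl⟩; exact ⟨q.2, hq⟩⟩
  · ext x
    constructor
    · rintro ⟨q, hq, rfl⟩
      exact ⟨hq.2, (hslice _ hq.2).1 (hmem q hq.1).2⟩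
    · rintro ⟨hx, hxT⟩
      obtain ⟨q, hq, rfl⟩ : x ∈ N.incl '' V := by
        rw [himg]
        exact ⟨(hsource x hx).2.1, (hslice x hx).2 hxT⟩
      exact ⟨q, ⟨hq, hx⟩, rfl⟩
  · intro q hq (v : E)
    obtain ⟨h1, h2, h3⟩ := hsource _ hq.2
    have hqF := (hmem q hq.1).2
    refine (htan' _ h2 hqF v).trans ?_
    change _ ↔ modelDeriv ℂ φ' (N.incl q) v ∈ T
    rw [chain _ h1 h2]
    have hCF : C (κ (N.incl q)) ∈ F := by rw [(memC _ h1 h2).2]; exact hqF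
    refine ((key _ h3).2 hCF _).trans ?_
    have hψd : DifferentiableAt ℂ ψ (κ (N.incl q)) :=
      (hψ.contDiffAt (ψ.open_source.mem_nhds h3)).differentiableAt (by simp)
    rw [modelDeriv_comp_chart dκC h1 hψd (f := φ') Filter.EventuallyEq.rfl v]

/-- Apart from being an integral manifold, the conditions on a leaf are purely topological and do
not involve the field. -/
theorem isLeaf_real_iff_complex [FiniteDimensional ℂ E]
    (hD : ∀ (x : X) (v : E), v ∈ (D' x : Submodule ℝ E) ↔ v ∈ (D x : Submodule ℂ E))
    (N : TopologizedSubset X) : IsLeaf D' N ↔ IsLeaf D N := by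
  have h : ∀ N : TopologizedSubset X, IsIntegralManifold D' N ↔ IsIntegralManifold D N :=
    fun N => ⟨fun hN => hN.complex_of_real hD, fun hN => hN.real_of_complex hD⟩
  constructor
  · rintro ⟨h1, h2, h3⟩
    exact ⟨(h N).1 h1, h2, fun N' hN' => h3 N' ((h N').2 hN')⟩
  · rintro ⟨h1, h2, h3⟩
    exact ⟨(h N).2 h1, h2, fun N' hN' => h3 N' ((h N').1 hN')⟩

end IntegralManifolds

/-! ### Second-order terms of iterated brackets, and duality -/

section ConstantCovectors

set_option maxSynthPendingDepth 3

variable {E : Type*} [NormedAddCommGroup E] [NormedSpace ℝ E]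

/-- The derivative of `R(dg, dh)` along the Hamiltonian vector `v a` of a covector `a`. -/
theorem bivector_fderiv_apply {R : E → (E →L[ℝ] ℝ) →L[ℝ] (E →L[ℝ] ℝ) →L[ℝ] ℝ} {u : E}
    (hR : DifferentiableAt ℝ R u) (hanti : ∀ a b, R u a b = -R u b a) (v : (E →L[ℝ] ℝ) → E)
    (hv : ∀ a b : E →L[ℝ] ℝ, b (v a) = R u a b) {g h : E → ℝ}
    (hg : DifferentiableAt ℝ (fderiv ℝ g) u) (hh : DifferentiableAt ℝ (fderiv ℝ h) u)
    (a : E →L[ℝ] ℝ) :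
    R u a (fderiv ℝ (fun y => R y (fderiv ℝ g y) (fderiv ℝ h y)) u)
      = R u a (fderiv ℝ (fun y => R y (fderiv ℝ g u) (fderiv ℝ h u)) u)
        - fderiv ℝ (fderiv ℝ g) u (v a) (v (fderiv ℝ h u))
        + fderiv ℝ (fderiv ℝ h) u (v a) (v (fderiv ℝ g u)) := by
  have h1 := (hR.hasFDerivAt.clm_apply hg.hasFDerivAt).clm_apply hh.hasFDerivAt
  have h2 := (hR.hasFDerivAt.clm_apply (hasFDerivAt_const (fderiv ℝ g u) u)).clm_apply
    (hasFDerivAt_const (fderiv ℝ h u) u)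
  -- Pairing with `R u a` is evaluation at `v a`, so the Leibniz rule applies; antisymmetry in the
  -- term with the Hessian of `g` produces the minus sign.
  rw [← hv, ← hv, h1.fderiv, h2.fderiv, hv (fderiv ℝ h u), hv (fderiv ℝ g u),
    hanti (fderiv ℝ h u)]
  simp
  ring

end ConstantCovectors

section Duality

variable {𝕜 : Type*} [NontriviallyNormedField 𝕜] [CompleteSpace 𝕜] {E : Type*}
  [NormedAddCommGroup E] [NormedSpace 𝕜 E] [FiniteDimensional 𝕜 E]

/-- Reflexivity of a finite-dimensional space; it provides the vector `π^♯ α` for a covector `α`. -/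
theorem exists_forall_apply_eq (ℓ : (E →L[𝕜] 𝕜) →ₗ[𝕜] 𝕜) :
    ∃ w : E, ∀ β : E →L[𝕜] 𝕜, β w = ℓ β := by
  let m : Module.Dual 𝕜 (Module.Dual 𝕜 E) :=
    ℓ ∘ₗ (LinearMap.toContinuousLinearMap : (E →ₗ[𝕜] 𝕜) ≃ₗ[𝕜] (E →L[𝕜] 𝕜)).toLinearMap
  obtain ⟨w, hw⟩ := (Module.evalEquiv 𝕜 E).surjective m
  refine ⟨w, fun β => ?_⟩
  have := congrArg (fun l => l (β : E →ₗ[𝕜] 𝕜)) hw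
  exact this

end Duality

/-! ### Brackets and scalar multiples of bivector fields -/

section Brackets

variable {𝕜 : Type*} [NontriviallyNormedField 𝕜]
  {E : Type*} [NormedAddCommGroup E] [NormedSpace 𝕜 E]
  {X : Type*} [TopologicalSpace X] [ChartedSpace E X]

namespace BivectorField

theorem form_anti (π : BivectorField 𝕜 E X) (x : X) (a b : CotangentAt 𝕜 E X x) :
    π.form x a b = -π.form x b a := by
  have h := π.form_self x (a + b)
  simp only [map_add, LinearMap.add_apply, π.form_self] at h
  linear_combination h

theorem bracket_congr (π : BivectorField 𝕜 E X) {f f' g g' : X → 𝕜} {x : X}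
    (hf : f =ᶠ[𝓝 x] f') (hg : g =ᶠ[𝓝 x] g') : π.bracket f g x = π.bracket f' g' x := by
  rw [bracket, bracket, differentialAt, differentialAt, hf.mfderiv_eq, hg.mfderiv_eq]
  rfl

theorem bracket_const_mul_right (π : BivectorField 𝕜 E X) {g : X → 𝕜} {x : X}
    (hg : MDifferentiableAt 𝓘(𝕜, E) 𝓘(𝕜, 𝕜) g x) (f : X → 𝕜) (c : 𝕜) :
    π.bracket f (fun y => c * g y) x = c * π.bracket f g x := by
  have h : differentialAt (E := E) (fun y => c * g y) x = c • differentialAt (E := E) g x :=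
    (hg.hasMFDerivAt.const_smul c).mfderiv
  rw [bracket, h, map_smul]
  rfl

/-- A scalar multiple of a bivector field. -/
noncomputable def scale (c : 𝕜) (π : BivectorField 𝕜 E X) : BivectorField 𝕜 E X where
  form x := c • π.form x
  form_self x α := by simp [π.form_self]

theorem bracket_scale (c : 𝕜) (π : BivectorField 𝕜 E X) (f g : X → 𝕜) (x : X) :
    (π.scale c).bracket f g x = c * π.bracket f g x := rfl

theorem IsPoisson.mdifferentiableAt_bracket {π : BivectorField 𝕜 E X} (hπ : π.IsPoisson)
    {U : Set X} (hU : IsOpen U) {f g : X → 𝕜} (hf : IsSmoothFunOn 𝕜 E f U)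
    (hg : IsSmoothFunOn 𝕜 E g U) {x : X} (hx : x ∈ U) :
    MDifferentiableAt 𝓘(𝕜, E) 𝓘(𝕜, 𝕜) (π.bracket f g) x :=
  ((hπ.smooth_bracket U f g hU hf hg).contMDiffAt (hU.mem_nhds hx)).mdifferentiableAt (by simp)

theorem IsPoisson.scale {π : BivectorField 𝕜 E X} (hπ : π.IsPoisson) (c : 𝕜) :
    (π.scale c).IsPoisson where
  smooth_bracket U f g hU hf hg :=
    (contDiff_const_smul c).contMDiff.comp_contMDiffOn (hπ.smooth_bracket U f g hU hf hg)
  jacobi U f g h hU hf hg hh x hx := by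
    have key : ∀ {f g h : X → 𝕜}, IsSmoothFunOn 𝕜 E g U → IsSmoothFunOn 𝕜 E h U →
        (π.scale c).bracket f ((π.scale c).bracket g h) x
          = c ^ 2 * π.bracket f (π.bracket g h) x := by
      intro f g h hg hh
      rw [bracket_scale]
      rw [show (π.scale c).bracket g h = fun y => c * π.bracket g h y from rfl,
        π.bracket_const_mul_right (hπ.mdifferentiableAt_bracket hU hg hh hx)]
      ring
    rw [key hg hh, key hh hf, key hf hg, ← mul_add, ← mul_add, hπ.jacobi U f g h hU hf hg hh x hx,
      mul_zero]

theorem mem_distribution_iff (π : BivectorField 𝕜 E X) (x : X) (v : E) :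
    v ∈ (π.distribution x : Submodule 𝕜 E) ↔ ∃ α : E →L[𝕜] 𝕜, ∀ β : E →L[𝕜] 𝕜,
      β v = π.form x α β := Iff.rfl

theorem distribution_scale (π : BivectorField 𝕜 E X) {c : 𝕜} (hc : c ≠ 0) :
    (π.scale c).distribution = π.distribution := by
  funext x
  ext v
  constructor
  · rintro ⟨α, hα⟩
    exact ⟨c • α, fun β => by rw [hα, map_smul]; rfl⟩
  · rintro ⟨α, hα⟩
    refine ⟨c⁻¹ • α, fun β => ?_⟩
    rw [hα, map_smul]
    exact (inv_mul_cancel_left₀ hc _).symm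

end BivectorField

end Brackets

/-! ### Reduction of the Poisson property to linear functions of charts -/

section Charts

set_option maxSynthPendingDepth 3

variable {E : Type*} [NormedAddCommGroup E] [NormedSpace ℝ E] [FiniteDimensional ℝ E]
  {X : Type*} [TopologicalSpace X] [ChartedSpace E X]

namespace BivectorField

/-- A bivector field in a chart. -/
noncomputable def chartForm (P : BivectorField ℝ E X) (κ : OpenPartialHomeomorph X E) (u : E) :
    (E →L[ℝ] ℝ) →L[ℝ] (E →L[ℝ] ℝ) →L[ℝ] ℝ :=
  LinearMap.toContinuousBilinearMap (
    LinearMap.mk₂ ℝ (fun a b : E →L[ℝ] ℝ => P.form (κ.symm u)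
        (a.comp (modelDeriv ℝ κ (κ.symm u)) : E →L[ℝ] ℝ)
        (b.comp (modelDeriv ℝ κ (κ.symm u)) : E →L[ℝ] ℝ))
      (fun a a' b => by
        rw [ContinuousLinearMap.add_comp]
        exact LinearMap.map_add₂ _ _ _ _)
      (fun c a b => by
        rw [ContinuousLinearMap.smul_comp]
        exact LinearMap.map_smul₂ _ _ _ _)
      (fun a b b' => by
        rw [ContinuousLinearMap.add_comp]
        exact map_add _ _ _)
      (fun c a b => by
        rw [ContinuousLinearMap.smul_comp]
        exact map_smul _ _ _))

theorem chartForm_apply (P : BivectorField ℝ E X) (κ : OpenPartialHomeomorph X E) (u : E)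
    (a b : E →L[ℝ] ℝ) : P.chartForm κ u a b = P.form (κ.symm u)
        (a.comp (modelDeriv ℝ κ (κ.symm u)) : E →L[ℝ] ℝ)
        (b.comp (modelDeriv ℝ κ (κ.symm u)) : E →L[ℝ] ℝ) := rfl

theorem bracket_eq_chartForm {κ : OpenPartialHomeomorph X E}
    (hκ : κ.MDifferentiable 𝓘(ℝ, E) 𝓘(ℝ, E)) (P : BivectorField ℝ E X) {x : X}
    (hx : x ∈ κ.source) {f g : X → ℝ} {f' g' : E → ℝ} (hf : f =ᶠ[𝓝 x] f' ∘ κ)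
    (hg : g =ᶠ[𝓝 x] g' ∘ κ) (hf' : DifferentiableAt ℝ f' (κ x))
    (hg' : DifferentiableAt ℝ g' (κ x)) :
    P.bracket f g x = P.chartForm κ (κ x) (fderiv ℝ f' (κ x)) (fderiv ℝ g' (κ x)) := by
  have h : ∀ {f : X → ℝ} {f' : E → ℝ}, f =ᶠ[𝓝 x] f' ∘ κ → DifferentiableAt ℝ f' (κ x) →
      differentialAt (E := E) f x
        = ((fderiv ℝ f' (κ x)).comp (modelDeriv ℝ κ x) : E →L[ℝ] ℝ) :=
    fun {f f'} hf hf' => show modelDeriv ℝ f x = (fderiv ℝ f' (κ x)).comp (modelDeriv ℝ κ x) from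
      ContinuousLinearMap.ext fun v => modelDeriv_comp_chart hκ hx hf' hf v
  rw [bracket, h hf hf', h hg hg', chartForm_apply, κ.left_inv hx]

/-- The Poisson property only has to be checked on the linear functions of the charts. -/
theorem isPoisson_of_linear [IsManifold 𝓘(ℝ, E) ∞ X] (P : BivectorField ℝ E X)
    (hsmooth : ∀ (x₀ : X) (a b : E →L[ℝ] ℝ), IsSmoothFunOn ℝ E
      (P.bracket (a ∘ chartAt E x₀) (b ∘ chartAt E x₀)) (chartAt E x₀).source)
    (hjacobi : ∀ (x : X) (a b c : E →L[ℝ] ℝ),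
      P.bracket (a ∘ chartAt E x) (P.bracket (b ∘ chartAt E x) (c ∘ chartAt E x)) x
        + P.bracket (b ∘ chartAt E x) (P.bracket (c ∘ chartAt E x) (a ∘ chartAt E x)) x
        + P.bracket (c ∘ chartAt E x) (P.bracket (a ∘ chartAt E x) (b ∘ chartAt E x)) x = 0) :
    P.IsPoisson := by
  have hatlas : ∀ x₀ : X, chartAt E x₀ ∈ IsManifold.maximalAtlas 𝓘(ℝ, E) ∞ X :=
    fun x₀ => IsManifold.chart_mem_maximalAtlas x₀
  have hd : ∀ x₀ : X, (chartAt E x₀).MDifferentiable 𝓘(ℝ, E) 𝓘(ℝ, E) :=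
    fun x₀ => mdifferentiable_of_mem_maximalAtlas (hatlas x₀)
  have hconst : ∀ x₀ : X, ∀ x ∈ (chartAt E x₀).source, ∀ b c : E →L[ℝ] ℝ,
      P.bracket (b ∘ chartAt E x₀) (c ∘ chartAt E x₀) x
        = P.chartForm (chartAt E x₀) (chartAt E x₀ x) b c := by
    intro x₀ x hx b c
    rw [P.bracket_eq_chartForm (hd x₀) hx Filter.EventuallyEq.rfl Filter.EventuallyEq.rfl
      b.differentiableAt c.differentiableAt, b.fderiv, c.fderiv]
  -- The entries of the bivector in a chart are brackets of linear functions of that chart.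
  have hR : ∀ x₀ : X, ContDiffOn ℝ ∞ (P.chartForm (chartAt E x₀)) (chartAt E x₀).target := by
    intro x₀
    refine contDiffOn_clm_apply.2 fun a => contDiffOn_clm_apply.2 fun b => ?_
    refine ContDiffOn.congr (((hsmooth x₀ a b).comp (contMDiffOn_symm_of_mem_maximalAtlas
      (hatlas x₀)) fun u hu => (chartAt E x₀).map_target hu).contDiffOn) fun u hu => ?_
    rw [Function.comp_apply, hconst x₀ _ ((chartAt E x₀).map_target hu),
      (chartAt E x₀).right_inv hu]
  have hloc : ∀ x₀ : X, ∀ x ∈ (chartAt E x₀).source, ∀ f : X → ℝ,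
      f =ᶠ[𝓝 x] (f ∘ (chartAt E x₀).symm) ∘ chartAt E x₀ := by
    intro x₀ x hx f
    filter_upwards [(chartAt E x₀).open_source.mem_nhds hx] with y hy
    simp [(chartAt E x₀).left_inv hy]
  have hΩ : ∀ (x₀ : X) (U : Set X), IsOpen U →
      IsOpen ((chartAt E x₀).target ∩ (chartAt E x₀).symm ⁻¹' U) :=
    fun x₀ U hU => (chartAt E x₀).symm.isOpen_inter_preimage hU
  have hf' : ∀ (x₀ : X) (U : Set X) (f : X → ℝ), IsSmoothFunOn ℝ E f U →
      ContDiffOn ℝ ∞ (f ∘ (chartAt E x₀).symm)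
        ((chartAt E x₀).target ∩ (chartAt E x₀).symm ⁻¹' U) :=
    fun x₀ U f hf => (ContMDiffOn.comp hf ((contMDiffOn_symm_of_mem_maximalAtlas
      (hatlas x₀)).mono Set.inter_subset_left) fun u hu => hu.2).contDiffOn
  let B : X → (X → ℝ) → (X → ℝ) → E → ℝ := fun x₀ f g u => P.chartForm (chartAt E x₀) u
    (fderiv ℝ (f ∘ (chartAt E x₀).symm) u) (fderiv ℝ (g ∘ (chartAt E x₀).symm) u)
  have hB : ∀ (x₀ : X) (U : Set X) (f g : X → ℝ), IsOpen U → IsSmoothFunOn ℝ E f U →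
      IsSmoothFunOn ℝ E g U →
      ContDiffOn ℝ ∞ (B x₀ f g) ((chartAt E x₀).target ∩ (chartAt E x₀).symm ⁻¹' U) := by
    intro x₀ U f g hU hf hg
    exact (((hR x₀).mono Set.inter_subset_left).clm_apply
      ((hf' x₀ U f hf).fderiv_of_isOpen (hΩ x₀ U hU) (by simp))).clm_apply
      ((hf' x₀ U g hg).fderiv_of_isOpen (hΩ x₀ U hU) (by simp))
  have hmem : ∀ (x₀ : X) (U : Set X), ∀ x ∈ (chartAt E x₀).source, x ∈ U →
      chartAt E x₀ x ∈ (chartAt E x₀).target ∩ (chartAt E x₀).symm ⁻¹' U := by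
    intro x₀ U x hx hxU
    refine ⟨(chartAt E x₀).map_source hx, ?_⟩
    rwa [Set.mem_preimage, (chartAt E x₀).left_inv hx]
  have hbracket : ∀ (x₀ : X) (U : Set X) (f g : X → ℝ), IsOpen U → IsSmoothFunOn ℝ E f U →
      IsSmoothFunOn ℝ E g U → ∀ x ∈ (chartAt E x₀).source, x ∈ U →
      P.bracket f g x = B x₀ f g (chartAt E x₀ x) := by
    intro x₀ U f g hU hf hg x hx hxU
    have hnhds := (hΩ x₀ U hU).mem_nhds (hmem x₀ U x hx hxU)
    exact P.bracket_eq_chartForm (hd x₀) hx (hloc x₀ x hx f) (hloc x₀ x hx g)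
      (((hf' x₀ U f hf).contDiffAt hnhds).differentiableAt (by simp))
      (((hf' x₀ U g hg).contDiffAt hnhds).differentiableAt (by simp))
  refine ⟨fun U f g hU hf hg => ?_, fun U f g h hU hf hg hh x hx => ?_⟩
  · refine contMDiffOn_of_locally_contMDiffOn fun x hx => ⟨(chartAt E x).source,
      (chartAt E x).open_source, mem_chart_source E x, ?_⟩
    refine ContMDiffOn.congr (f := B x f g ∘ chartAt E x) ?_
      fun y hy => hbracket x U f g hU hf hg y hy.2 hy.1
    exact (hB x U f g hU hf hg).contMDiffOn.comp
      ((contMDiffOn_of_mem_maximalAtlas (hatlas x)).mono Set.inter_subset_right)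
      fun y hy => hmem x U y hy.2 hy.1
  · have hxs := mem_chart_source E x
    have hu := hmem x U x hxs hx
    have hnhds := (hΩ x U hU).mem_nhds hu
    have hRd : DifferentiableAt ℝ (P.chartForm (chartAt E x)) (chartAt E x x) :=
      ((hR x).contDiffAt ((chartAt E x).open_target.mem_nhds hu.1)).differentiableAt (by simp)
    have hanti : ∀ a b, P.chartForm (chartAt E x) (chartAt E x x) a b
        = -P.chartForm (chartAt E x) (chartAt E x x) b a := fun a b => by
      rw [chartForm_apply, chartForm_apply]
      exact P.form_anti _ _ _
    choose v hv using fun a : E →L[ℝ] ℝ => exists_forall_apply_eq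
      (P.chartForm (chartAt E x) (chartAt E x x) a : (E →L[ℝ] ℝ) →ₗ[ℝ] ℝ)
    have hsym : ∀ {f : X → ℝ}, IsSmoothFunOn ℝ E f U →
        IsSymmSndFDerivAt ℝ (f ∘ (chartAt E x).symm) (chartAt E x x) := fun hf =>
      ((hf' x U _ hf).contDiffAt hnhds).isSymmSndFDerivAt
        (by simp; exact WithTop.coe_le_coe.2 (le_top (a := (2 : ℕ∞))))
    have hdd : ∀ {f : X → ℝ}, IsSmoothFunOn ℝ E f U →
        DifferentiableAt ℝ (fderiv ℝ (f ∘ (chartAt E x).symm)) (chartAt E x x) := fun hf =>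
      (((hf' x U _ hf).fderiv_of_isOpen (hΩ x U hU) (m := ∞) (by simp)).contDiffAt
        hnhds).differentiableAt (by simp)
    have hiter : ∀ {f g h : X → ℝ}, IsSmoothFunOn ℝ E f U → IsSmoothFunOn ℝ E g U →
        IsSmoothFunOn ℝ E h U → P.bracket f (P.bracket g h) x
          = P.chartForm (chartAt E x) (chartAt E x x)
            (fderiv ℝ (f ∘ (chartAt E x).symm) (chartAt E x x))
            (fderiv ℝ (B x g h) (chartAt E x x)) := by
      intro f g h hf hg hh
      refine P.bracket_eq_chartForm (hd x) hxs (hloc x x hxs f) ?_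
        (((hf' x U f hf).contDiffAt hnhds).differentiableAt (by simp))
        (((hB x U g h hU hg hh).contDiffAt hnhds).differentiableAt (by simp))
      filter_upwards [hU.mem_nhds hx, (chartAt E x).open_source.mem_nhds hxs] with y hy hy'
      exact hbracket x U g h hU hg hh y hy' hy
    have hiterc : ∀ a b c : E →L[ℝ] ℝ,
        P.bracket (a ∘ chartAt E x) (P.bracket (b ∘ chartAt E x) (c ∘ chartAt E x)) x
          = P.chartForm (chartAt E x) (chartAt E x x) a
            (fderiv ℝ (fun y => P.chartForm (chartAt E x) y b c) (chartAt E x x)) := by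
      intro a b c
      rw [P.bracket_eq_chartForm (hd x) hxs Filter.EventuallyEq.rfl
        (g' := fun y => P.chartForm (chartAt E x) y b c) ?_ a.differentiableAt
        ((hRd.clm_apply (differentiableAt_const b)).clm_apply (differentiableAt_const c)),
        a.fderiv]
      filter_upwards [(chartAt E x).open_source.mem_nhds hxs] with y hy
      exact hconst x y hy b c
    -- The linear functions with the same differentials at `x` as `f`, `g`, `h`: their Jacobi sum
    -- differs from the wanted one only by Hessian terms.
    have h0 := hjacobi x (fderiv ℝ (f ∘ (chartAt E x).symm) (chartAt E x x))
      (fderiv ℝ (g ∘ (chartAt E x).symm) (chartAt E x x))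
      (fderiv ℝ (h ∘ (chartAt E x).symm) (chartAt E x x))
    rw [hiterc, hiterc, hiterc] at h0
    rw [hiter hf hg hh, hiter hg hh hf, hiter hh hf hg,
      bivector_fderiv_apply hRd hanti v hv (hdd hg) (hdd hh),
      bivector_fderiv_apply hRd hanti v hv (hdd hh) (hdd hf),
      bivector_fderiv_apply hRd hanti v hv (hdd hf) (hdd hg),
      -- Each Hessian occurs twice with opposite signs and exchanged arguments, so symmetry cancels
      -- all six terms.
      (hsym hf).eq (v (fderiv ℝ (g ∘ (chartAt E x).symm) (chartAt E x x))),
      (hsym hg).eq (v (fderiv ℝ (h ∘ (chartAt E x).symm) (chartAt E x x))),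
      (hsym hh).eq (v (fderiv ℝ (f ∘ (chartAt E x).symm) (chartAt E x x)))]
    linear_combination h0

end BivectorField

end Charts

/-! ### The real part of a holomorphic Poisson bivector field -/

section RealPart

variable {E : Type*} [NormedAddCommGroup E] [NormedSpace ℂ E]
  {X : Type*} [TopologicalSpace X] [ChartedSpace E X]

/-- The `(1,0)`-part of a real covector. -/
noncomputable def holomorphicPart (a : E →L[ℝ] ℝ) : E →L[ℂ] ℂ :=
  (((1 / 2 : ℝ) • (Complex.ofRealCLM.comp a
    - Complex.I • (Complex.ofRealCLM.comp a).comp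
      ((Complex.I • ContinuousLinearMap.id ℂ E).restrictScalars ℝ))) :
    E →L[ℝ] ℂ).toComplexLinear fun w => by
    simp [smul_smul]
    ring_nf
    simp
    ring

theorem holomorphicPart_apply (a : E →L[ℝ] ℝ) (v : E) :
    holomorphicPart a v = (a v - Complex.I * a (Complex.I • v)) / 2 := by
  change (1 / 2 : ℝ) • ((a v : ℂ) - Complex.I * (a (Complex.I • v) : ℂ)) = _
  rw [Complex.real_smul]
  push_cast
  ring

theorem onePart_ofReal (x : X) (a : E →L[ℝ] ℝ) :
    onePart x (Complex.ofRealCLM.comp a : E →L[ℝ] ℂ) = holomorphicPart a :=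
  ContinuousLinearMap.ext fun v : E => (holomorphicPart_apply a v).symm

theorem holomorphicPart_re (a : E →L[ℝ] ℝ) (v : E) : (holomorphicPart a v).re = a v / 2 := by
  rw [holomorphicPart_apply]
  simp

/-- The real part of `l` is `(l + conj l)/2`, and only `l/2` is of type (1,0). -/
theorem holomorphicPart_of_re (l : E →L[ℂ] ℂ) (c : ℝ) :
    holomorphicPart (c • Complex.reCLM.comp (l.restrictScalars ℝ)) = (c / 2 : ℂ) • l := by
  ext v
  rw [holomorphicPart_apply]
  apply Complex.ext <;> simp <;> ring

namespace BivectorField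

/-- The bilinear form at a point, on covectors of the model space. -/
noncomputable def modelForm (π : BivectorField ℂ E X) (x : X) :
    (E →L[ℂ] ℂ) →ₗ[ℂ] (E →L[ℂ] ℂ) →ₗ[ℂ] ℂ := π.form x

theorem realPart_form (π : BivectorField ℂ E X) (x : X) (a b : E →L[ℝ] ℝ) :
    π.realPart.form x a b = (π.modelForm x (holomorphicPart a) (holomorphicPart b)).re := by
  change (π.modelForm x (onePart x (Complex.ofRealCLM.comp a : E →L[ℝ] ℂ))
    (onePart x (Complex.ofRealCLM.comp b : E →L[ℝ] ℂ))).re = _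
  rw [onePart_ofReal, onePart_ofReal]

/-- Since `Im z = Re(-i z)`, every result on real parts also covers imaginary parts. -/
theorem imaginaryPart_eq (π : BivectorField ℂ E X) :
    π.imaginaryPart = (π.scale (-Complex.I)).realPart := by
  have h : π.imaginaryPart.form = (π.scale (-Complex.I)).realPart.form := by
    funext x
    ext a b
    change (complexValue π x a b).im = (-Complex.I * complexValue π x a b).re
    simp
  cases hπ : π.imaginaryPart
  cases hπ' : (π.scale (-Complex.I)).realPart
  rw [hπ, hπ'] at h
  congr

theorem mem_realPart_distribution_iff [FiniteDimensional ℂ E] (π : BivectorField ℂ E X) (x : X)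
    (v : E) : v ∈ (π.realPart.distribution x : Submodule ℝ E)
      ↔ v ∈ (π.distribution x : Submodule ℂ E) := by
  rw [mem_distribution_iff, mem_distribution_iff]
  constructor
  · rintro ⟨α, hα⟩
    obtain ⟨w, hw⟩ := exists_forall_apply_eq (π.modelForm x (holomorphicPart α))
    have hv : v = (1 / 2 : ℝ) • w := by
      refine (SeparatingDual.eq_iff_forall_dual_eq (R := ℝ)).2 fun β => ?_
      rw [hα β, realPart_form]
      have := congrArg Complex.re (hw (holomorphicPart β))
      rw [holomorphicPart_re] at this
      rw [map_smul, smul_eq_mul, ← this]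
      ring
    -- Here `w` is `π^♯` of the (1,0)-part of `α`, and `v = w/2`.
    refine ⟨(1 / 2 : ℂ) • holomorphicPart (E := E) α, fun β => ?_⟩
    have h1 : β v = (1 / 2 : ℂ) * β w := by
      rw [hv, show ((1 / 2 : ℝ) • w) = (1 / 2 : ℂ) • w by
        rw [← Complex.coe_smul]; norm_num, map_smul, smul_eq_mul]
    rw [h1, hw β]
    exact (LinearMap.map_smul₂ (π.modelForm x) (1 / 2 : ℂ) (holomorphicPart α) β).symm
  · rintro ⟨l, hl⟩
    -- One factor 2 makes up for the (1,0)-part of `Re l` being `l/2`, the other for `Re β' = β/2`.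
    refine ⟨(4 : ℝ) • Complex.reCLM.comp (l.restrictScalars ℝ), fun β => ?_⟩
    rw [realPart_form, holomorphicPart_of_re]
    have h1 : _ = (π.modelForm x l (holomorphicPart β)).re :=
      congrArg Complex.re (hl (holomorphicPart β))
    rw [holomorphicPart_re] at h1
    have h2 : π.modelForm x (((4 : ℝ) / 2 : ℂ) • l) (holomorphicPart β)
        = ((4 : ℝ) / 2 : ℂ) * π.modelForm x l (holomorphicPart β) :=
      LinearMap.map_smul₂ (π.modelForm x) _ _ _
    rw [h2, show ((4 : ℝ) / 2 : ℂ) = ((2 : ℝ) : ℂ) by norm_num, Complex.re_ofReal_mul, ← h1]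
    ring

/-- The trivial factor `1` puts the derivative in the form required by `holomorphicPart_of_re`. -/
theorem modelDeriv_re {f : X → ℂ} {x : X} (hf : MDifferentiableAt 𝓘(ℂ, E) 𝓘(ℂ, ℂ) f x) :
    modelDeriv (E := E) ℝ (fun y => (f y).re) x
      = (1 : ℝ) • Complex.reCLM.comp ((modelDeriv ℂ f x).restrictScalars ℝ) := by
  have h : HasMFDerivAt 𝓘(ℝ, E) 𝓘(ℝ, ℝ) (Complex.reCLM ∘ f) x
      (Complex.reCLM.comp ((modelDeriv ℂ f x).restrictScalars ℝ) : E →L[ℝ] ℝ) :=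
    Complex.reCLM.hasFDerivAt.hasMFDerivAt.comp x hf.hasMFDerivAt_real
  rw [one_smul]
  exact h.mfderiv

/-- The (1,0)-part of `d(Re f)` is `df/2`; the two halves give the factor 1/4. -/
theorem realPart_bracket_re (π : BivectorField ℂ E X) {f g : X → ℂ} {x : X}
    (hf : MDifferentiableAt 𝓘(ℂ, E) 𝓘(ℂ, ℂ) f x) (hg : MDifferentiableAt 𝓘(ℂ, E) 𝓘(ℂ, ℂ) g x) :
    π.realPart.bracket (fun y => (f y).re) (fun y => (g y).re) x
      = ((1 / 4 : ℂ) * π.bracket f g x).re := by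
  refine (π.realPart_form x (modelDeriv ℝ (fun y => (f y).re) x)
    (modelDeriv ℝ (fun y => (g y).re) x)).trans ?_
  rw [modelDeriv_re hf, modelDeriv_re hg, holomorphicPart_of_re, holomorphicPart_of_re]
  have h : ∀ (c : ℂ) (a b : E →L[ℂ] ℂ), π.modelForm x (c • a) (c • b) = c * (c * π.modelForm x a b) := by
    intro c a b
    refine (LinearMap.map_smul₂ (π.modelForm x) c a _).trans ?_
    exact congrArg (c * ·) (map_smul (π.modelForm x a) c b)
  rw [h, ← mul_assoc]
  congr 2
  norm_num

theorem _root_.IsSmoothFunOn.re {f : X → ℂ} {U : Set X} (hf : IsSmoothFunOn ℂ E f U) :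
    IsSmoothFunOn ℝ E (fun y => (f y).re) U := by
  have h : ContMDiffOn 𝓘(ℝ, E) 𝓘(ℝ, ℂ) ∞ f U :=
    fun x hx => ⟨(hf x hx).1, ContDiffWithinAt.restrict_scalars ℝ (hf x hx).2⟩
  exact Complex.reCLM.contDiff.contMDiff.comp_contMDiffOn h

theorem IsPoisson.realPart [FiniteDimensional ℂ E] [IsManifold 𝓘(ℂ, E) ∞ X]
    {π : BivectorField ℂ E X} (hπ : π.IsPoisson) : π.realPart.IsPoisson := by
  have hfin : FiniteDimensional ℝ E := FiniteDimensional.complexToReal E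
  have hman : IsManifold 𝓘(ℝ, E) ∞ X := isManifold_real_of_complex
  -- The holomorphic function with real part `a ∘ chartAt E x₀`; the factor 2 undoes `Re a' = a/2`.
  let F : X → (E →L[ℝ] ℝ) → X → ℂ := fun x₀ a y => ((2 : ℂ) • holomorphicPart (E := E) a) (chartAt E x₀ y)
  have hFre : ∀ x₀ (a : E →L[ℝ] ℝ), a ∘ chartAt E x₀ = fun y => (F x₀ a y).re := by
    intro x₀ a
    funext y
    have := holomorphicPart_re a (chartAt E x₀ y)
    simp only [F, Function.comp_apply, smul_apply, smul_eq_mul, Complex.mul_re,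
      Complex.re_ofNat, Complex.im_ofNat, zero_mul, sub_zero, this]
    ring
  have hF : ∀ x₀ a, IsSmoothFunOn ℂ E (F x₀ a) (chartAt E x₀).source := fun x₀ a =>
    ((2 : ℂ) • holomorphicPart a).contDiff.contMDiff.comp_contMDiffOn
      (contMDiffOn_of_mem_maximalAtlas (IsManifold.chart_mem_maximalAtlas x₀))
  have hFd : ∀ x₀ a, ∀ x ∈ (chartAt E x₀).source,
      MDifferentiableAt 𝓘(ℂ, E) 𝓘(ℂ, ℂ) (F x₀ a) x := fun x₀ a x hx =>
    ((hF x₀ a).contMDiffAt ((chartAt E x₀).open_source.mem_nhds hx)).mdifferentiableAt (by simp)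
  have hB : ∀ x₀ (a b : E →L[ℝ] ℝ), ∀ x ∈ (chartAt E x₀).source,
      π.realPart.bracket (a ∘ chartAt E x₀) (b ∘ chartAt E x₀) x
        = ((1 / 4 : ℂ) * π.bracket (F x₀ a) (F x₀ b) x).re := by
    intro x₀ a b x hx
    rw [hFre, hFre]
    exact π.realPart_bracket_re (hFd x₀ a x hx) (hFd x₀ b x hx)
  have hsm : ∀ x₀ a b, IsSmoothFunOn ℂ E (fun x => (1 / 4 : ℂ) * π.bracket (F x₀ a) (F x₀ b) x)
      (chartAt E x₀).source := fun x₀ a b =>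
    (contDiff_const_smul (1 / 4 : ℂ)).contMDiff.comp_contMDiffOn
      (hπ.smooth_bracket _ _ _ (chartAt E x₀).open_source (hF x₀ a) (hF x₀ b))
  refine isPoisson_of_linear _ (fun x₀ a b => ?_) fun x a b c => ?_
  · exact ContMDiffOn.congr (hsm x₀ a b).re (hB x₀ a b)
  · have hx := mem_chart_source E x
    have hnhds := (chartAt E x).open_source.mem_nhds hx
    -- The inner bracket is itself the real part of a holomorphic function, so the bracket formula
    -- applies twice, giving 1/16 = (1/4)².
    have key : ∀ a b c : E →L[ℝ] ℝ, π.realPart.bracket (a ∘ chartAt E x)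
        (π.realPart.bracket (b ∘ chartAt E x) (c ∘ chartAt E x)) x
          = ((1 / 16 : ℂ) * π.bracket (F x a) (π.bracket (F x b) (F x c)) x).re := by
      intro a b c
      rw [π.realPart.bracket_congr Filter.EventuallyEq.rfl
        (Filter.eventually_of_mem hnhds (hB x b c)), hFre,
        π.realPart_bracket_re (hFd x a x hx)
          (((hsm x b c).contMDiffAt hnhds).mdifferentiableAt (by simp)),
        π.bracket_const_mul_right (hπ.mdifferentiableAt_bracket (chartAt E x).open_source
          (hF x b) (hF x c) hx)]
      congr 1
      ring
    rw [key, key, key, ← Complex.add_re, ← Complex.add_re, ← mul_add, ← mul_add,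
      hπ.jacobi _ _ _ _ (chartAt E x).open_source (hF x a) (hF x b) (hF x c) x hx, mul_zero,
      Complex.zero_re]

end BivectorField

end RealPart

theorem mainTheorem9
    {E : Type*} [NormedAddCommGroup E] [NormedSpace ℂ E] [FiniteDimensional ℂ E]
    {X : Type*} [TopologicalSpace X] [T2Space X] [SecondCountableTopology X]
    [ChartedSpace E X] [IsManifold 𝓘(ℂ, E) ∞ X]
    (π : BivectorField ℂ E X) (hπ : π.IsPoisson) :
    (π.realPart.IsPoisson ∧ π.imaginaryPart.IsPoisson) ∧
    π.realPart.symplecticFoliation = π.imaginaryPart.symplecticFoliation ∧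
    π.realPart.symplecticFoliation = π.symplecticFoliation := by
  -- Stated for all `σ` so as to apply both to `π` and to `-iπ`, whose real part is `π_I`.
  have key : ∀ σ : BivectorField ℂ E X,
      σ.realPart.symplecticFoliation = σ.symplecticFoliation := fun σ =>
    Set.ext fun N => isLeaf_real_iff_complex (fun x v => σ.mem_realPart_distribution_iff x v) N
  have hscale : (π.scale (-Complex.I)).symplecticFoliation = π.symplecticFoliation := by
    rw [BivectorField.symplecticFoliation, BivectorField.symplecticFoliation,
      π.distribution_scale (neg_ne_zero.2 Complex.I_ne_zero)]
  rw [π.imaginaryPart_eq, key, key, hscale]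
  exact ⟨⟨hπ.realPart, (hπ.scale (-Complex.I)).realPart⟩, rfl, rfl⟩
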